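/- Let $\mathfrak S_n$ be the symmetric group with adjacent transpositions $s_1,\dots,s_{n-1}$ as generators. An expression $s_{i_1}\cdots s_{i_k}$ for $w$ is *reduced* if it is as short as possible. The one-line notation $w_1\cdots w_n$ of $w$ is obtained by letting an expression for $w$ act on the word $1\cdots n$, where $s_j$ swaps the letters in positions $j$ and $j+1$. In the *Bruhat order*, $u\le v$ if every reduced expression for $v$ contains a reduced expression for $u$ as a subword. In the *weak order*, $u\le_W v$ if some reduced expression for $v$ ends with a reduced expression for $u$. Let $\mathcal A$ be the quantum matrix bialgebra, i.e. the associative unital algebra over $\mathbb Z[q^{1/2},q^{-1/2}]$ generated by $x_{i,j}$ ($1\le i,j\le n$) subject to $$x_{i,\ell}x_{i,k}=q^{1/2}x_{i,k}x_{i,\ell},\qquad x_{j,k}x_{i,\ell}=x_{i,\ell}x_{j,k},$$ $$x_{j,k}x_{i,k}=q^{1/2}x_{i,k}x_{j,k},\qquad x_{j,\ell}x_{i,k}=x_{i,k}x_{j,\ell}+(q^{1/2}-q^{-1/2})x_{i,\ell}x_{j,k}$$ for all $i<j$ and $k<\ell$. For $u,v\in\mathfrak S_n$ put $x^{u,v}=x_{u_1,v_1}\cdots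 x_{u_n,v_n}$. The *zero-weight space* of $\mathcal A$ is the submodule spanned by all $x^{u,v}$ with $u,v\in\mathfrak S_n$. For $v,w\in\mathfrak S_n$ and an expression $s_{i_1}\cdots s_{i_k}$, let $C^b_{v,w}(s_{i_1}\cdots s_{i_k})$ be the set of sequences $\pi=(\pi^{(0)},\dots,\pi^{(k)})$ in $\mathfrak S_n$ such that 1. $\pi^{(0)}=v$ and $\pi^{(k)}=w$; 2. $\pi^{(j)}\in\{s_{i_j}\pi^{(j-1)},\pi^{(j-1)}\}$ for $j=1,\dots,k$; 3. $\pi^{(j)}=s_{i_j}\pi^{(j-1)}$ whenever $s_{i_j}\pi^{(j-1)}>\pi^{(j-1)}$ in the Bruhat order, for $j=1,\dots,k$; 4. $\pi^{(j)}=\pi^{(j-1)}$ for exactly $b$ values of $j\in\{1,\dots,k\}$. **Theorem.** Let $t,u\in\mathfrak S_n$ with $t\le_W u$. Then $\{x^{t,w}\mid w\in\mathfrak S_n\}$ is a basis of the zero-weight space, and there are unique polynomials $r_{u,v,t,w}(q_1)\in\mathbb N[q_1]$ $(v,w\in\mathfrak S_n)$ with $$x^{u,v}=\sum_{w\in\mathfrak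 S_n} r_{u,v,t,w}(q^{1/2}-q^{-1/2})\,x^{t,w}\qquad\text{for all } v\in\mathfrak S_n.$$ For every reduced expression $s_{i_1}\cdots s_{i_k}$ of $ut^{-1}$ and all $v,w\in\mathfrak S_n$ they satisfy $$r_{u,v,t,w}(q_1)=p_{u,v,t,w}(q_1;s_{i_1}\cdots s_{i_k}):=\sum_b |C^b_{v,w}(s_{i_1}\cdots s_{i_k})|\,q_1^b .$$ In particular the polynomials $p_{u,v,t,w}(q_1;s_{i_1}\cdots s_{i_k})$ do not depend on the reduced expression chosen for $ut^{-1}$. -/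

import Mathlib

namespace QuantumMatrix

noncomputable section

open Polynomial LaurentPolynomial

/- ### The symmetric group, reduced expressions, Bruhat order and weak order -/

/-- The `j`-th adjacent transposition, a generator of the symmetric group on `n` letters.
(The letters and the generators are numbered from `0`.) -/
def s {n : ℕ} (j : Fin (n - 1)) : Equiv.Perm (Fin n) :=
  Equiv.swap ⟨j.1, by have := j.2; omega⟩ ⟨j.1 + 1, by have := j.2; omega⟩

/-- The product of the generators in an expression, read from left to right. -/
def wordProd {n : ℕ} (l : List (Fin (n - 1))) : Equiv.Perm (Fin n) := (l.map s).prod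

/-- `l` is a reduced (shortest possible) expression for `w`. -/
def IsReducedExpr {n : ℕ} (l : List (Fin (n - 1))) (w : Equiv.Perm (Fin n)) : Prop :=
  wordProd l = w ∧ ∀ l' : List (Fin (n - 1)), wordProd l' = w → l.length ≤ l'.length

/-- Bruhat order: every reduced expression for `v` contains, as a subword, a reduced
expression for `u`. -/
def BruhatLE {n : ℕ} (u v : Equiv.Perm (Fin n)) : Prop :=
  ∀ l, IsReducedExpr l v → ∃ l', IsReducedExpr l' u ∧ l'.Sublist l

/-- Strict Bruhat order. -/
def BruhatLT {n : ℕ} (u v : Equiv.Perm (Fin n)) : Prop := BruhatLE u v ∧ u ≠ v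

/-- Weak order: some reduced expression for `v` ends with a reduced expression for `u`. -/
def WeakLE {n : ℕ} (u v : Equiv.Perm (Fin n)) : Prop :=
  ∃ l l', IsReducedExpr (l ++ l') v ∧ IsReducedExpr l' u

/-- The `i`-th letter of the one-line notation of `w`. One-line notation is obtained by letting
an expression for `w` act on the word `1 ⋯ n`, the generator `s j` swapping the letters in
*positions* `j` and `j + 1` (see `oneLine_one` and `oneLine_s_mul`); products of permutations being
compositions of functions, this is the inverse function of `w`. -/
def oneLine {n : ℕ} (w : Equiv.Perm (Fin n)) (i : Fin n) : Fin n := w⁻¹ i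

theorem oneLine_one {n : ℕ} (i : Fin n) : oneLine 1 i = i := rfl

theorem oneLine_s_mul {n : ℕ} (j : Fin (n - 1)) (w : Equiv.Perm (Fin n)) (i : Fin n) :
    oneLine (s j * w) i = oneLine w (s j i) := by
  simp [oneLine, s, mul_inv_rev]

/- ### The quantum matrix bialgebra (as an algebra) and its zero-weight space -/

/-- The ground ring `ℤ[q^{1/2}, q^{-1/2}]`: Laurent polynomials in the variable `T 1 = q^{1/2}`. -/
abbrev L : Type := LaurentPolynomial ℤ

/-- `q^{1/2} - q^{-1/2}`. -/
def qdiff : L := T 1 - T (-1)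

/-- The free generator indexed by row `i` and column `j`. -/
def freeVar {n : ℕ} (i j : Fin n) : FreeAlgebra L (Fin n × Fin n) := FreeAlgebra.ι L (i, j)

/-- The defining relations of the quantum matrix bialgebra, for `i < j` and `k < l`. -/
inductive Rel (n : ℕ) :
    FreeAlgebra L (Fin n × Fin n) → FreeAlgebra L (Fin n × Fin n) → Prop
  | row (i k l : Fin n) (hkl : k < l) :
      Rel n (freeVar i l * freeVar i k) ((T 1 : L) • (freeVar i k * freeVar i l))
  | col (i j k : Fin n) (hij : i < j) :
      Rel n (freeVar j k * freeVar i k) ((T 1 : L) • (freeVar i k * freeVar j k))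
  | anti (i j k l : Fin n) (hij : i < j) (hkl : k < l) :
      Rel n (freeVar j k * freeVar i l) (freeVar i l * freeVar j k)
  | diag (i j k l : Fin n) (hij : i < j) (hkl : k < l) :
      Rel n (freeVar j l * freeVar i k)
        (freeVar i k * freeVar j l + qdiff • (freeVar i l * freeVar j k))

/-- The quantum matrix bialgebra `𝒜(n; q)`, as an associative unital algebra. -/
abbrev A (n : ℕ) : Type := RingQuot (Rel n)

/-- The generator `x_{i,j}` of `𝒜(n; q)`. -/
def x {n : ℕ} (i j : Fin n) : A n := RingQuot.mkAlgHom L (Rel n) (freeVar i j)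

/-- The monomial `x^{u,v} = x_{u_1,v_1} ⋯ x_{u_n,v_n}`. -/
def mon {n : ℕ} (u v : Equiv.Perm (Fin n)) : A n :=
  (List.ofFn fun i : Fin n => x (oneLine u i) (oneLine v i)).prod

/-- The zero-weight space: the span of all monomials `x^{u,v}`. -/
def zeroWeightSpace (n : ℕ) : Submodule L (A n) :=
  Submodule.span L (Set.range fun p : Equiv.Perm (Fin n) × Equiv.Perm (Fin n) => mon p.1 p.2)

/-- The polynomials `r v w = r_{u,v,t,w}(q₁)` expand the monomials `x^{u,v}` in the monomials
`x^{t,w}`: for all `v`, `x^{u,v} = ∑_w r_{u,v,t,w}(q^{1/2} - q^{-1/2}) x^{t,w}`. -/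
def IsTransition {n : ℕ} (u t : Equiv.Perm (Fin n))
    (r : Equiv.Perm (Fin n) → Equiv.Perm (Fin n) → ℕ[X]) : Prop :=
  ∀ v, mon u v = ∑ w, (aeval qdiff (r v w) : L) • mon t w

/- ### Walks -/

/-- The walks `π = (π⁽⁰⁾, …, π⁽ᵏ⁾)` from `v` to `w` that follow the expression
`l = s_{i_1} ⋯ s_{i_k}` and stay in place at exactly `b` steps. A step may stay in place only if
`s_{i_j} π⁽ʲ⁻¹⁾` is not above `π⁽ʲ⁻¹⁾`. When `l` is a reduced expression for `u t⁻¹`, this is the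
set `C^b_{u,v,t,w}(s_{i_1} ⋯ s_{i_k})`. -/
def walks {n : ℕ} (l : List (Fin (n - 1))) (v w : Equiv.Perm (Fin n)) (b : ℕ) :
    Set (Fin (l.length + 1) → Equiv.Perm (Fin n)) :=
  {π | π 0 = v ∧ π (Fin.last l.length) = w ∧
    (∀ j : Fin l.length,
      π j.succ = s (l.get j) * π j.castSucc ∨ π j.succ = π j.castSucc) ∧
    (∀ j : Fin l.length, BruhatLT (π j.castSucc) (s (l.get j) * π j.castSucc) →
      π j.succ = s (l.get j) * π j.castSucc) ∧
    {j : Fin l.length | π j.succ = π j.castSucc}.ncard = b}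

/-- The walk-counting polynomial `∑_b |C^b| q₁^b` (the sets are empty for `b` larger than
the length of the expression). When `l` is a reduced expression `s_{i_1} ⋯ s_{i_k}` for `u t⁻¹`,
this is `p_{u,v,t,w}(q₁; s_{i_1} ⋯ s_{i_k})`. -/
def walkPoly {n : ℕ} (l : List (Fin (n - 1))) (v w : Equiv.Perm (Fin n)) : ℕ[X] :=
  ∑ b ∈ Finset.range (l.length + 1), Polynomial.C (walks l v w b).ncard * X ^ b

end

end QuantumMatrix

/-! Everything rests on one straightening rule (`mon_s_mul`): if `s_j u > u`, then `x^{s_j u, v}`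
equals `x^{u, s_j v}`, plus `(q^{1/2} - q^{-1/2}) x^{u,v}` when `s_j v < v`. Only the factors in
positions `j` and `j + 1` differ, and there the rule is one of the last two kinds of defining
relation. Since `t ≤_W u`, a reduced word of `u t⁻¹` followed by a suitable reduced word of `t` is
reduced for `u`, so its letters can be stripped from the left, each by the rule. Walk polynomials
obey the same recursion on the first letter (`walkPoly_cons`), which gives the expansion
(`mon_wordProd_append`).

Spanning holds because the rule can be inverted over the ground ring. Linear independence needs a
model: send `x^{u,v}` to `T_{u⁻¹} T_v` in the regular representation of the Hecke algebra, and every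
other word in the generators to zero. This respects the defining relations, hence descends to the
quotient; for fixed `u` it is left multiplication by `T_{u⁻¹}`, which is injective. Instead of braid
relations, the model uses that left and right multiplications commute and that an operator commuting
with the right ones is determined by its value at `e_1`.

Polynomials are unique because `q^{1/2} - q^{-1/2}` is transcendental (`aeval_qdiff_injective`);
independence of the reduced word then follows from uniqueness. -/

namespace QuantumMatrix

noncomputable section

open Polynomial LaurentPolynomial

/- ### Ascents and the exchange property in the symmetric group -/

/-- The smaller of the two letters moved by `s j`. -/
def lo {n : ℕ} (j : Fin (n - 1)) : Fin n := ⟨j.1, by have := j.2; omega⟩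

/-- The larger of the two letters moved by `s j`. -/
def hi {n : ℕ} (j : Fin (n - 1)) : Fin n := ⟨j.1 + 1, by have := j.2; omega⟩

/-- The one-line notation of `w` increases from position `j` to position `j + 1`. -/
def LeftAscent {n : ℕ} (j : Fin (n - 1)) (w : Equiv.Perm (Fin n)) : Prop :=
  w⁻¹ (lo j) < w⁻¹ (hi j)

instance {n : ℕ} (j : Fin (n - 1)) (w : Equiv.Perm (Fin n)) : Decidable (LeftAscent j w) :=
  inferInstanceAs (Decidable (_ < _))

section Words

variable {n : ℕ}

theorem lo_lt_hi (j : Fin (n - 1)) : lo j < hi j := by simp [lo, hi]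

theorem lo_ne_hi (j : Fin (n - 1)) : lo j ≠ hi j := (lo_lt_hi j).ne

theorem s_eq_swap (j : Fin (n - 1)) : s j = Equiv.swap (lo j) (hi j) := rfl

@[simp] theorem s_lo (j : Fin (n - 1)) : s j (lo j) = hi j := Equiv.swap_apply_left _ _

@[simp] theorem s_hi (j : Fin (n - 1)) : s j (hi j) = lo j := Equiv.swap_apply_right _ _

@[simp] theorem s_inv (j : Fin (n - 1)) : (s j)⁻¹ = s j := Equiv.swap_inv _ _

@[simp] theorem s_mul_s (j : Fin (n - 1)) : s j * s j = 1 := Equiv.swap_mul_self _ _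

@[simp] theorem s_mul_s_mul (j : Fin (n - 1)) (w : Equiv.Perm (Fin n)) : s j * (s j * w) = w := by
  rw [← mul_assoc, s_mul_s, one_mul]

@[simp] theorem mul_s_mul_s (j : Fin (n - 1)) (w : Equiv.Perm (Fin n)) : w * s j * s j = w := by
  rw [mul_assoc, s_mul_s, mul_one]

theorem s_ne_one (j : Fin (n - 1)) : s j ≠ 1 := fun h =>
  lo_ne_hi j (by rw [← s_hi, h, Equiv.Perm.one_apply])

theorem s_mul_ne (j : Fin (n - 1)) (w : Equiv.Perm (Fin n)) : s j * w ≠ w := fun h =>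
  s_ne_one j (by simpa using h)

/-- `s j` preserves the order of every pair of letters other than `j, j + 1`. -/
theorem s_lt_s {j : Fin (n - 1)} {p q : Fin n} (hpq : p < q) (h : ¬(p = lo j ∧ q = hi j)) :
    s j p < s j q := by
  rw [s_eq_swap, Equiv.swap_apply_def, Equiv.swap_apply_def]
  simp only [lo, hi, Fin.ext_iff, Fin.lt_def] at *
  split_ifs <;> try simp only
  all_goals omega

theorem leftAscent_s_mul (j : Fin (n - 1)) (w : Equiv.Perm (Fin n)) :
    LeftAscent j (s j * w) ↔ ¬LeftAscent j w := by
  have h : w⁻¹ (lo j) ≠ w⁻¹ (hi j) := fun h => lo_ne_hi j (w⁻¹.injective h)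
  simp only [LeftAscent, mul_inv_rev, s_inv, Equiv.Perm.mul_apply, s_lo, s_hi, not_lt]
  exact ⟨le_of_lt, fun h' => lt_of_le_of_ne h' (Ne.symm h)⟩

@[simp] theorem wordProd_nil : wordProd ([] : List (Fin (n - 1))) = 1 := rfl

@[simp] theorem wordProd_cons (j : Fin (n - 1)) (l : List (Fin (n - 1))) :
    wordProd (j :: l) = s j * wordProd l := by simp [wordProd]

@[simp] theorem wordProd_append (l l' : List (Fin (n - 1))) :
    wordProd (l ++ l') = wordProd l * wordProd l' := by simp [wordProd]

theorem exists_wordProd (w : Equiv.Perm (Fin n)) : ∃ l, wordProd l = w := by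
  have hw : w ∈ Submonoid.closure (Set.range (s (n := n))) := by
    cases n with
    | zero => rw [Subsingleton.elim w 1]; exact one_mem _
    | succ m =>
      have h := Equiv.Perm.mclosure_swap_castSucc_succ m
      have h' : w ∈ (⊤ : Submonoid (Equiv.Perm (Fin (m + 1)))) := trivial
      rw [← h] at h'
      refine Submonoid.closure_mono ?_ h'
      rintro _ ⟨i, rfl⟩
      exact ⟨i, rfl⟩
  induction hw using Submonoid.closure_induction with
  | mem _ h => obtain ⟨j, rfl⟩ := h; exact ⟨[j], by simp⟩
  | one => exact ⟨[], rfl⟩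
  | mul a b _ _ ha hb =>
    obtain ⟨l, rfl⟩ := ha
    obtain ⟨l', rfl⟩ := hb
    exact ⟨l ++ l', by simp⟩

theorem exists_isReducedExpr (w : Equiv.Perm (Fin n)) : ∃ l, IsReducedExpr l w := by
  classical
  have h : ∃ k, ∃ l : List (Fin (n - 1)), wordProd l = w ∧ l.length = k :=
    let ⟨l, hl⟩ := exists_wordProd w
    ⟨_, l, hl, rfl⟩
  obtain ⟨l, hl, hk⟩ := Nat.find_spec h
  exact ⟨l, hl, fun l' hl' => hk ▸ Nat.find_min' h ⟨l', hl', rfl⟩⟩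

/-- The strong exchange property. -/
theorem exists_sublist_swap_mul (l : List (Fin (n - 1))) {p q : Fin n} (hpq : p < q)
    (h : (wordProd l)⁻¹ q < (wordProd l)⁻¹ p) :
    ∃ l' : List (Fin (n - 1)), l'.Sublist l ∧ l'.length + 1 = l.length ∧
      wordProd l' = Equiv.swap p q * wordProd l := by
  induction l generalizing p q with
  | nil => exact absurd h (by simpa using hpq.le)
  | cons a l ih =>
    by_cases hc : p = lo a ∧ q = hi a
    -- Here the transposition is the first letter itself, which is deleted; otherwise `s a` keeps
    -- `p, q` in order, and induction applies to the conjugated transposition.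
    · refine ⟨l, List.sublist_cons_self _ _, rfl, ?_⟩
      rw [hc.1, hc.2, ← s_eq_swap, wordProd_cons, s_mul_s_mul]
    · obtain ⟨l', hl', hlen, hw⟩ := ih (s_lt_s hpq hc) (by simpa using h)
      refine ⟨a :: l', hl'.cons_cons a, by simp [hlen], ?_⟩
      rw [wordProd_cons, hw, wordProd_cons, ← mul_assoc, ← mul_assoc, Equiv.swap_apply_apply]
      simp [mul_assoc]

theorem exists_sublist_s_mul (l : List (Fin (n - 1))) {j : Fin (n - 1)}
    (h : ¬LeftAscent j (wordProd l)) :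
    ∃ l' : List (Fin (n - 1)), l'.Sublist l ∧ l'.length + 1 = l.length ∧
      wordProd l' = s j * wordProd l := by
  refine exists_sublist_swap_mul l (lo_lt_hi j) (lt_of_le_of_ne (not_lt.mp h) fun h' => ?_)
  exact lo_ne_hi j ((wordProd l)⁻¹.injective h'.symm)

theorem IsReducedExpr.of_append_right {l l' : List (Fin (n - 1))} {w : Equiv.Perm (Fin n)}
    (h : IsReducedExpr (l ++ l') w) : IsReducedExpr l' (wordProd l') := by
  refine ⟨rfl, fun m hm => ?_⟩
  have := h.2 (l ++ m) (by rw [wordProd_append, hm, ← wordProd_append, h.1])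
  simpa using this

theorem IsReducedExpr.tail {j : Fin (n - 1)} {l : List (Fin (n - 1))} {w : Equiv.Perm (Fin n)}
    (h : IsReducedExpr (j :: l) w) : IsReducedExpr l (wordProd l) :=
  IsReducedExpr.of_append_right (l := [j]) h

/-- At a descent, exchange would delete a letter of `l` and yield an expression two letters shorter
than `j :: l`. -/
theorem IsReducedExpr.leftAscent {j : Fin (n - 1)} {l : List (Fin (n - 1))}
    {w : Equiv.Perm (Fin n)} (h : IsReducedExpr (j :: l) w) : LeftAscent j (wordProd l) := by
  by_contra hc
  obtain ⟨l', -, hlen, hw⟩ := exists_sublist_s_mul l hc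
  have := h.2 l' (by rw [hw, ← wordProd_cons, h.1])
  simp at this
  omega

theorem IsReducedExpr.exists_s_mul {j : Fin (n - 1)} {l : List (Fin (n - 1))}
    {w : Equiv.Perm (Fin n)} (hl : IsReducedExpr l w) (h : ¬LeftAscent j w) :
    ∃ l', IsReducedExpr l' (s j * w) ∧ l'.Sublist l ∧ l'.length + 1 = l.length := by
  obtain ⟨rfl, hmin⟩ := hl
  obtain ⟨l', hsub, hlen, hw⟩ := exists_sublist_s_mul l h
  refine ⟨l', ⟨hw, fun m hm => ?_⟩, hsub, hlen⟩
  have := hmin (j :: m) (by rw [wordProd_cons, hm, s_mul_s_mul])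
  simp at this
  omega

/-- Left multiplication by a generator goes up in the Bruhat order exactly at the ascents. -/
theorem bruhatLT_s_mul_iff (j : Fin (n - 1)) (w : Equiv.Perm (Fin n)) :
    BruhatLT w (s j * w) ↔ LeftAscent j w := by
  constructor
  · rintro ⟨hle, -⟩
    by_contra hc
    obtain ⟨l, hl⟩ := exists_isReducedExpr w
    obtain ⟨l', hl', -, hlen⟩ := hl.exists_s_mul hc
    obtain ⟨m, hm, hsub⟩ := hle l' hl'
    have h1 := hl.2 m hm.1
    have h2 := hsub.length_le
    omega
  · intro h
    refine ⟨fun l hl => ?_, (s_mul_ne j w).symm⟩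
    obtain ⟨l', hl', hsub, -⟩ :=
      hl.exists_s_mul (j := j) (by rw [leftAscent_s_mul]; exact not_not.mpr h)
    exact ⟨l', by simpa using hl', hsub⟩

/-- If `t ≤ u` in the weak order, then reduced expressions of `u t⁻¹` and of `t` concatenate to
reduced expressions of `u`. -/
theorem WeakLE.exists_isReducedExpr_append {t u : Equiv.Perm (Fin n)} (h : WeakLE t u) :
    ∃ m, IsReducedExpr m t ∧ ∀ l, IsReducedExpr l (u * t⁻¹) → IsReducedExpr (l ++ m) u := by
  obtain ⟨a, b, hab, hb⟩ := h
  refine ⟨b, hb, fun l hl => ?_⟩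
  -- The prefix `a` also expresses `u t⁻¹`, so `l` is no longer than `a` and `l ++ b` no longer than
  -- the reduced word `a ++ b`.
  have hu : wordProd a * t = u := by rw [← hb.1, ← wordProd_append, hab.1]
  have hla := hl.2 a (by rw [← hu, mul_inv_cancel_right])
  refine ⟨by rw [wordProd_append, hl.1, hb.1, inv_mul_cancel_right], fun m hm => ?_⟩
  have := hab.2 m hm
  simp at this ⊢
  omega

end Words

/- ### Adjacent entries of words and the straightening relation -/

section Straightening

variable {n : ℕ}

/-- The outer parts `p` and `q` are chosen before `g`, so all monomials differing only in positions
`j, j + 1` share them. -/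
theorem exists_ofFn_eq_append {α : Type*} (f : Fin n → α) (j : Fin (n - 1)) :
    ∃ p q : List α, p.length = j ∧ ∀ g : Fin n → α, (∀ i, i ≠ lo j → i ≠ hi j → g i = f i) →
      List.ofFn g = p ++ g (lo j) :: g (hi j) :: q := by
  have hj := j.2
  refine ⟨(List.ofFn f).take j, (List.ofFn f).drop (j + 2), by simp; omega, fun g hg => ?_⟩
  have h1 : (List.ofFn f).take j = (List.ofFn g).take j := by
    refine List.ext_getElem (by simp) fun i h _ => ?_
    simp only [List.length_take, List.length_ofFn, lt_min_iff] at h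
    simp only [List.getElem_take, List.getElem_ofFn]
    exact (hg _ (by simp [lo, Fin.ext_iff]; omega) (by simp [hi, Fin.ext_iff]; omega)).symm
  have h2 : (List.ofFn f).drop (j + 2) = (List.ofFn g).drop (j + 2) := by
    refine List.ext_getElem (by simp) fun i h _ => ?_
    simp only [List.length_drop, List.length_ofFn] at h
    simp only [List.getElem_drop, List.getElem_ofFn]
    exact (hg _ (by simp [lo, Fin.ext_iff]; omega) (by simp [hi, Fin.ext_iff]; omega)).symm
  rw [h1, h2]
  conv_lhs => rw [← List.take_append_drop j (List.ofFn g)]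
  rw [List.drop_eq_getElem_cons (i := j) (by simp; omega),
    List.drop_eq_getElem_cons (i := j + 1) (by simp; omega)]
  simp [lo, hi]

theorem exists_of_ofFn_eq_append {α : Type*} {f : Fin n → α} {p q : List α} {a b : α}
    (h : List.ofFn f = p ++ a :: b :: q) :
    ∃ j : Fin (n - 1), f (lo j) = a ∧ f (hi j) = b ∧
      ∀ g : Fin n → α, (∀ i, i ≠ lo j → i ≠ hi j → g i = f i) →
        List.ofFn g = p ++ g (lo j) :: g (hi j) :: q := by
  have hlen : n = p.length + (q.length + 2) := by simpa using congrArg List.length h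
  obtain ⟨p', q', hp', hg⟩ := exists_ofFn_eq_append f (⟨p.length, by omega⟩ : Fin (n - 1))
  have h' := hg f fun _ _ _ => rfl
  rw [h] at h'
  obtain ⟨h1, h2⟩ := List.append_inj h' hp'.symm
  simp only [List.cons.injEq] at h2
  obtain ⟨h3, h4, h5⟩ := h2
  subst h1 h5
  exact ⟨_, h3.symm, h4.symm, hg⟩

/-- The pair of indices at position `i` of the monomial `x^{u,v}`. -/
def entry (u v : Equiv.Perm (Fin n)) (i : Fin n) : Fin n × Fin n := (u⁻¹ i, v⁻¹ i)

theorem s_apply_of_ne {j : Fin (n - 1)} {i : Fin n} (h1 : i ≠ lo j) (h2 : i ≠ hi j) :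
    s j i = i := Equiv.swap_apply_of_ne_of_ne h1 h2

/-- The product of generators along a list of index pairs. -/
def xprod (l : List (Fin n × Fin n)) : A n := (l.map fun p => x p.1 p.2).prod

theorem mon_eq_xprod (u v : Equiv.Perm (Fin n)) : mon u v = xprod (List.ofFn (entry u v)) := by
  simp only [mon, xprod, List.map_ofFn]
  rfl

theorem x_anti {i j k l : Fin n} (hij : i < j) (hkl : k < l) : x j k * x i l = x i l * x j k := by
  simpa [x] using RingQuot.mkAlgHom_rel L (Rel.anti i j k l hij hkl)

theorem x_diag {i j k l : Fin n} (hij : i < j) (hkl : k < l) :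
    x j l * x i k = x i k * x j l + qdiff • (x i l * x j k) := by
  simpa [x] using RingQuot.mkAlgHom_rel L (Rel.diag i j k l hij hkl)

/-- The straightening relation `x^{su,v} = x^{u,sv} + [sv < v] (q^{1/2} - q^{-1/2}) x^{u,v}` for
`su > u`. -/
theorem mon_s_mul {u : Equiv.Perm (Fin n)} {j : Fin (n - 1)} (hu : LeftAscent j u)
    (v : Equiv.Perm (Fin n)) :
    mon (s j * u) v = mon u (s j * v) + if LeftAscent j v then 0 else qdiff • mon u v := by
  obtain ⟨p, q, -, h⟩ := exists_ofFn_eq_append (entry u v) j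
  have h1 := h (entry (s j * u) v) fun i h1 h2 => by simp [entry, s_apply_of_ne h1 h2]
  have h2 := h (entry u (s j * v)) fun i h1 h2 => by simp [entry, s_apply_of_ne h1 h2]
  have h3 := h (entry u v) fun i h1 h2 => rfl
  simp only [mon_eq_xprod, h1, h2, h3]
  simp only [xprod, entry, List.map_append, List.map_cons, List.prod_append, List.prod_cons,
    mul_inv_rev, s_inv, Equiv.Perm.mul_apply, s_lo, s_hi]
  generalize (List.map (fun p => x p.1 p.2) p).prod = P
  generalize (List.map (fun p => x p.1 p.2) q).prod = Q
  simp only [← mul_assoc _ _ Q]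
  split_ifs with hv
  · rw [x_anti hu hv, add_zero]
  · have hv' : v⁻¹ (hi j) < v⁻¹ (lo j) :=
      lt_of_le_of_ne (not_lt.mp hv) fun h' => lo_ne_hi j (v⁻¹.injective h'.symm)
    rw [x_diag hu hv', mul_add, add_mul, mul_smul_comm, smul_mul_assoc]

/-- On each pair `{v, s_j v}` the straightening rule is a triangular system with unit diagonal,
hence invertible over `L`. -/
theorem span_mon_s_mul_of_leftAscent {u : Equiv.Perm (Fin n)} {j : Fin (n - 1)}
    (hu : LeftAscent j u) :
    Submodule.span L (Set.range (mon (s j * u))) = Submodule.span L (Set.range (mon u)) := by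
  have hsub : ∀ (w v : Equiv.Perm (Fin n)), mon w v ∈ Submodule.span L (Set.range (mon w)) :=
    fun w v => Submodule.subset_span ⟨v, rfl⟩
  apply le_antisymm <;> rw [Submodule.span_le]
  · rintro _ ⟨v, rfl⟩
    rw [mon_s_mul hu]
    refine add_mem (hsub _ _) ?_
    split_ifs
    exacts [zero_mem _, Submodule.smul_mem _ _ (hsub _ _)]
  · have hasc : ∀ v, LeftAscent j v →
        mon u (s j * v) ∈ Submodule.span L (Set.range (mon (s j * u))) := fun v hv => by
      have := mon_s_mul hu v
      rw [if_pos hv, add_zero] at this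
      exact this ▸ hsub _ _
    rintro _ ⟨v, rfl⟩
    by_cases hv : LeftAscent j v
    -- The rule at the descent `s_j v` contains `x^{u,v}`; its correction term is a multiple of
    -- `x^{u, s_j v}`, already in the span by the ascent case.
    · have h := mon_s_mul hu (s j * v)
      rw [if_neg (by rw [leftAscent_s_mul]; exact not_not.mpr hv), s_mul_s_mul] at h
      have h' : mon u v = mon (s j * u) (s j * v) + (-qdiff) • mon u (s j * v) := by
        rw [h, add_assoc, ← add_smul, add_neg_cancel, zero_smul, add_zero]
      rw [SetLike.mem_coe, h']
      exact add_mem (hsub _ _) (Submodule.smul_mem _ _ (hasc v hv))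
    · simpa using hasc (s j * v) ((leftAscent_s_mul j v).mpr hv)

theorem span_mon_s_mul (u : Equiv.Perm (Fin n)) (j : Fin (n - 1)) :
    Submodule.span L (Set.range (mon (s j * u))) = Submodule.span L (Set.range (mon u)) := by
  by_cases hu : LeftAscent j u
  · exact span_mon_s_mul_of_leftAscent hu
  · simpa using (span_mon_s_mul_of_leftAscent ((leftAscent_s_mul j u).mpr hu)).symm

theorem span_mon_eq_span_mon_one (u : Equiv.Perm (Fin n)) :
    Submodule.span L (Set.range (mon u)) = Submodule.span L (Set.range (mon 1)) := by
  obtain ⟨l, rfl⟩ := exists_wordProd u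
  induction l with
  | nil => rfl
  | cons j l ih => rw [wordProd_cons, span_mon_s_mul, ih]

theorem span_mon (t : Equiv.Perm (Fin n)) :
    Submodule.span L (Set.range (mon t)) = zeroWeightSpace n := by
  apply le_antisymm
  · exact Submodule.span_mono (by rintro _ ⟨v, rfl⟩; exact ⟨(t, v), rfl⟩)
  · rw [zeroWeightSpace, Submodule.span_le]
    rintro _ ⟨⟨u, v⟩, rfl⟩
    rw [SetLike.mem_coe, span_mon_eq_span_mon_one, ← span_mon_eq_span_mon_one u]
    exact Submodule.subset_span ⟨v, rfl⟩

end Straightening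

/- ### The regular representation of the Hecke algebra -/

section Hecke

variable {n : ℕ}

theorem s_mul_eq_mul_s {a b : Fin (n - 1)} {v : Equiv.Perm (Fin n)}
    (h : v (lo b) = lo a ∧ v (hi b) = hi a ∨ v (lo b) = hi a ∧ v (hi b) = lo a) :
    s a * v = v * s b := by
  have h' : s a = v * s b * v⁻¹ := by
    rw [s_eq_swap b, ← Equiv.swap_apply_apply]
    rcases h with ⟨h1, h2⟩ | ⟨h1, h2⟩
    · rw [h1, h2, s_eq_swap]
    · rw [h1, h2, s_eq_swap, Equiv.swap_comm]
  rw [h', inv_mul_cancel_right]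

/-- Multiplying by `s b` can reverse the two compared values only if they are `lo b` and `hi b`,
which would force `s a * v = v * s b`. -/
theorem leftAscent_mul_s {a b : Fin (n - 1)} {v : Equiv.Perm (Fin n)} (h : s a * v ≠ v * s b) :
    LeftAscent a (v * s b) ↔ LeftAscent a v := by
  simp only [LeftAscent, mul_inv_rev, s_inv, Equiv.Perm.mul_apply]
  have hne : v⁻¹ (lo a) ≠ v⁻¹ (hi a) := fun h => lo_ne_hi a (v⁻¹.injective h)
  rcases lt_or_gt_of_ne hne with hlt | hgt
  · refine iff_of_true (s_lt_s hlt fun hc => h (s_mul_eq_mul_s (Or.inl ?_))) hlt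
    rw [← hc.1, ← hc.2]
    simp
  · refine iff_of_false (not_lt.mpr (s_lt_s hgt fun hc => h (s_mul_eq_mul_s (Or.inr ?_))).le)
      (not_lt.mpr hgt.le)
    rw [← hc.1, ← hc.2]
    simp

theorem leftAscent_iff_of_s_mul_eq_mul_s {a b : Fin (n - 1)} {v : Equiv.Perm (Fin n)}
    (h : s a * v = v * s b) : LeftAscent a v ↔ LeftAscent b v⁻¹ := by
  have h1 : s a (v (lo b)) = v (hi b) := by
    rw [← Equiv.Perm.mul_apply, h, Equiv.Perm.mul_apply, s_lo]
  have hne : v (lo b) ≠ v (hi b) := fun h => lo_ne_hi b (v.injective h)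
  simp only [LeftAscent, inv_inv]
  by_cases hlo : v (lo b) = lo a
  · have hhi : v (hi b) = hi a := by rw [← h1, hlo, s_lo]
    rw [Equiv.Perm.inv_eq_iff_eq.mpr hlo.symm, Equiv.Perm.inv_eq_iff_eq.mpr hhi.symm, hlo, hhi]
    exact iff_of_true (lo_lt_hi b) (lo_lt_hi a)
  · by_cases hhi : v (lo b) = hi a
    · have hlo' : v (hi b) = lo a := by rw [← h1, hhi, s_hi]
      rw [Equiv.Perm.inv_eq_iff_eq.mpr hhi.symm, Equiv.Perm.inv_eq_iff_eq.mpr hlo'.symm, hhi, hlo']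
      exact iff_of_false (lo_lt_hi b).asymm (lo_lt_hi a).asymm
    · exact absurd (h1.symm.trans (s_apply_of_ne hlo hhi)) hne.symm

/-- The standard basis vector `e_v` of the regular representation. -/
abbrev basisVec (v : Equiv.Perm (Fin n)) : Equiv.Perm (Fin n) →₀ L := Finsupp.single v 1

/-- Left multiplication by the Hecke generator `T_j`. -/
def leftMul (j : Fin (n - 1)) : Module.End L (Equiv.Perm (Fin n) →₀ L) :=
  Finsupp.linearCombination L fun v =>
    basisVec (s j * v) + if LeftAscent j v then 0 else qdiff • basisVec v

/-- Right multiplication by the Hecke generator `T_j`. -/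
def rightMul (j : Fin (n - 1)) : Module.End L (Equiv.Perm (Fin n) →₀ L) :=
  Finsupp.linearCombination L fun v =>
    basisVec (v * s j) + if LeftAscent j v⁻¹ then 0 else qdiff • basisVec v

theorem leftMul_basisVec (j : Fin (n - 1)) (v : Equiv.Perm (Fin n)) :
    leftMul j (basisVec v) =
      basisVec (s j * v) + if LeftAscent j v then 0 else qdiff • basisVec v := by
  rw [leftMul, Finsupp.linearCombination_single, one_smul]

theorem rightMul_basisVec (j : Fin (n - 1)) (v : Equiv.Perm (Fin n)) :
    rightMul j (basisVec v) =
      basisVec (v * s j) + if LeftAscent j v⁻¹ then 0 else qdiff • basisVec v := by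
  rw [rightMul, Finsupp.linearCombination_single, one_smul]

theorem end_ext {P Q : Module.End L (Equiv.Perm (Fin n) →₀ L)}
    (h : ∀ v, P (basisVec v) = Q (basisVec v)) : P = Q :=
  Finsupp.lhom_ext' fun v => LinearMap.ext_ring (h v)

/-- If `s a * v ≠ v * s b`, neither multiplication affects the other's ascent test. If they are
equal, the two tests coincide and flip together. -/
theorem leftMul_commute_rightMul (a b : Fin (n - 1)) : Commute (leftMul a) (rightMul b) := by
  refine end_ext fun v => ?_
  simp only [Module.End.mul_apply, leftMul_basisVec, rightMul_basisVec, map_add,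
    apply_ite (leftMul a), apply_ite (rightMul b), map_zero, map_smul]
  by_cases h : s a * v = v * s b
  · have h1 := leftAscent_iff_of_s_mul_eq_mul_s h
    have h2 : LeftAscent b (s a * v)⁻¹ ↔ ¬LeftAscent a v := by
      rw [← leftAscent_s_mul]
      exact (leftAscent_iff_of_s_mul_eq_mul_s (by rw [mul_assoc, ← h])).symm
    simp only [← mul_assoc, ← h, leftAscent_s_mul, h2, ← h1]
    by_cases hv : LeftAscent a v <;> simp [hv]
    all_goals rw [h, mul_s_mul_s]
  · have h1 : LeftAscent b (s a * v)⁻¹ ↔ LeftAscent b v⁻¹ := by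
      rw [mul_inv_rev, s_inv]
      refine leftAscent_mul_s fun h' => h ?_
      simpa [eq_comm] using congrArg (·⁻¹) h'
    simp only [leftAscent_mul_s h, h1, mul_assoc]
    by_cases hv : LeftAscent a v <;> by_cases hw : LeftAscent b v⁻¹ <;> simp [hv, hw]
    abel

theorem leftMul_mul_leftMul (j : Fin (n - 1)) :
    leftMul (n := n) j * leftMul j = 1 + qdiff • leftMul j := by
  refine end_ext fun v => ?_
  simp only [Module.End.mul_apply, LinearMap.add_apply, LinearMap.smul_apply, Module.End.one_apply,
    leftMul_basisVec, map_add, apply_ite (leftMul j), map_zero, map_smul, s_mul_s_mul, leftAscent_s_mul]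
  by_cases hv : LeftAscent j v <;> simp [hv]

/-- The quadratic relation makes `T_j - (q^{1/2} - q^{-1/2})` an inverse of `T_j`. -/
theorem leftMul_injective (j : Fin (n - 1)) : Function.Injective (leftMul (n := n) j) := by
  intro a b h
  have h' : ∀ m, m = leftMul j (leftMul j m) - qdiff • leftMul j m := fun m => by
    rw [← Module.End.mul_apply, leftMul_mul_leftMul]
    simp
  rw [h' a, h' b, h]

/-- An operator commuting with all right multiplications is determined by its value at `e_1`. -/
theorem end_ext_of_commute {P Q : Module.End L (Equiv.Perm (Fin n) →₀ L)}
    (hP : ∀ j, Commute P (rightMul j)) (hQ : ∀ j, Commute Q (rightMul j))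
    (h : P (basisVec 1) = Q (basisVec 1)) : P = Q := by
  have key : ∀ l : List (Fin (n - 1)), P (basisVec (wordProd l)⁻¹) = Q (basisVec (wordProd l)⁻¹) := by
    intro l
    induction l with
    | nil => simpa using h
    | cons j l ih =>
      -- Inverting the word turns prepending `j` into right multiplication by `s j`, so the new
      -- basis vector comes from the old one by `rightMul j` up to a multiple of the old one.
      have hr : basisVec (wordProd (j :: l))⁻¹ = rightMul j (basisVec (wordProd l)⁻¹) +
          -(if LeftAscent j (wordProd l) then 0 else qdiff • basisVec (wordProd l)⁻¹) := by
        rw [rightMul_basisVec, inv_inv, add_neg_cancel_right, wordProd_cons, mul_inv_rev, s_inv]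
      have hPj : P (rightMul j (basisVec (wordProd l)⁻¹)) =
          rightMul j (P (basisVec (wordProd l)⁻¹)) := LinearMap.congr_fun (hP j) _
      have hQj : Q (rightMul j (basisVec (wordProd l)⁻¹)) =
          rightMul j (Q (basisVec (wordProd l)⁻¹)) := LinearMap.congr_fun (hQ j) _
      rw [hr, map_add, map_add, hPj, hQj, ih, map_neg, map_neg]
      split_ifs
      · simp
      · rw [map_smul, map_smul, ih]
  refine end_ext fun v => ?_
  obtain ⟨l, hl⟩ := exists_wordProd v⁻¹
  simpa [hl] using key l

/-- Left multiplication by the product of Hecke generators along a word. -/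
def leftMulWord (l : List (Fin (n - 1))) : Module.End L (Equiv.Perm (Fin n) →₀ L) :=
  (l.map leftMul).prod

theorem leftMulWord_cons (j : Fin (n - 1)) (l : List (Fin (n - 1))) :
    leftMulWord (j :: l) = leftMul j * leftMulWord l := by simp [leftMulWord]

theorem leftMulWord_commute_rightMul (l : List (Fin (n - 1))) (b : Fin (n - 1)) :
    Commute (leftMulWord l) (rightMul b) := by
  induction l with
  | nil => exact Commute.one_left _
  | cons j l ih => rw [leftMulWord_cons]; exact (leftMul_commute_rightMul j b).mul_left ih

theorem leftMulWord_injective (l : List (Fin (n - 1))) : Function.Injective (leftMulWord l) := by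
  induction l with
  | nil => exact Function.injective_id
  | cons j l ih => rw [leftMulWord_cons]; exact (leftMul_injective j).comp ih

theorem leftMulWord_basisVec_one {l : List (Fin (n - 1))} {w : Equiv.Perm (Fin n)}
    (hl : IsReducedExpr l w) : leftMulWord l (basisVec 1) = basisVec w := by
  induction l generalizing w with
  | nil => rw [← hl.1]; rfl
  | cons j l ih =>
    rw [leftMulWord_cons, Module.End.mul_apply, ih hl.tail, leftMul_basisVec,
      if_pos hl.leftAscent, add_zero, ← wordProd_cons, hl.1]

/-- Left multiplication by the standard basis element `T_w`. -/
def leftMulPerm (w : Equiv.Perm (Fin n)) : Module.End L (Equiv.Perm (Fin n) →₀ L) :=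
  leftMulWord (exists_isReducedExpr w).choose

theorem leftMulPerm_basisVec_one (w : Equiv.Perm (Fin n)) :
    leftMulPerm w (basisVec 1) = basisVec w :=
  leftMulWord_basisVec_one (exists_isReducedExpr w).choose_spec

/-- Both sides commute with right multiplications and send `e_1` to `e_{w s_j}`, so the reduced
words chosen in `leftMulPerm` do not matter. -/
theorem leftMulPerm_mul_s {w : Equiv.Perm (Fin n)} {j : Fin (n - 1)} (h : LeftAscent j w⁻¹) :
    leftMulPerm (w * s j) = leftMulPerm w * leftMul j := by
  have hw : ∀ b, Commute (leftMulPerm w) (rightMul b) := leftMulWord_commute_rightMul _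
  refine end_ext_of_commute (leftMulWord_commute_rightMul _)
    (fun b => (hw b).mul_left (leftMul_commute_rightMul j b)) ?_
  have h1 : LeftAscent j (1 : Equiv.Perm (Fin n)) := by simpa [LeftAscent] using lo_lt_hi j
  have h2 : leftMul j (basisVec 1) = rightMul j (basisVec 1) := by
    rw [leftMul_basisVec, rightMul_basisVec, inv_one, if_pos h1, mul_one, one_mul]
  rw [leftMulPerm_basisVec_one, Module.End.mul_apply, h2, ← Module.End.mul_apply, (hw j).eq,
    Module.End.mul_apply, leftMulPerm_basisVec_one, rightMul_basisVec, if_pos h, add_zero]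

/-- The image `T_{u⁻¹} T_v` of the monomial `x^{u,v}` in the Hecke algebra. -/
def heckeMon (u v : Equiv.Perm (Fin n)) : Equiv.Perm (Fin n) →₀ L :=
  leftMulPerm u⁻¹ (basisVec v)

/-- The Hecke counterpart of `mon_s_mul`: `T_{u⁻¹ s_j} T_v = T_{u⁻¹} (T_j T_v)`. -/
theorem heckeMon_s_mul {u : Equiv.Perm (Fin n)} {j : Fin (n - 1)} (hu : LeftAscent j u)
    (v : Equiv.Perm (Fin n)) :
    heckeMon (s j * u) v =
      heckeMon u (s j * v) + if LeftAscent j v then 0 else qdiff • heckeMon u v := by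
  simp only [heckeMon]
  rw [mul_inv_rev, s_inv, leftMulPerm_mul_s (by rwa [inv_inv]), Module.End.mul_apply,
    leftMul_basisVec, map_add, apply_ite (leftMulPerm u⁻¹), map_zero, map_smul]

end Hecke

/- ### Linear independence of the monomials -/

section Independence

variable {n : ℕ}

theorem entry_injective {u v u' v' : Equiv.Perm (Fin n)} (h : entry u v = entry u' v') :
    u = u' ∧ v = v' := by
  have h' : ∀ i, u⁻¹ i = u'⁻¹ i ∧ v⁻¹ i = v'⁻¹ i := fun i => Prod.ext_iff.mp (congrFun h i)
  exact ⟨inv_injective (Equiv.ext fun i => (h' i).1), inv_injective (Equiv.ext fun i => (h' i).2)⟩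

/-- The list consists of the index pairs of some monomial `x^{u,v}`. -/
def IsEntryList (l : List (Fin n × Fin n)) : Prop :=
  ∃ p : Equiv.Perm (Fin n) × Equiv.Perm (Fin n), l = List.ofFn (entry p.1 p.2)

open Classical in
/-- The value of a word in the Hecke algebra, zero for words other than the `x^{u,v}`. -/
def wordValue (l : List (Fin n × Fin n)) : Equiv.Perm (Fin n) →₀ L :=
  if h : IsEntryList l then heckeMon h.choose.1 h.choose.2 else 0

theorem wordValue_ofFn (u v : Equiv.Perm (Fin n)) :
    wordValue (List.ofFn (entry u v)) = heckeMon u v := by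
  have h : IsEntryList (List.ofFn (entry u v)) := ⟨(u, v), rfl⟩
  obtain ⟨h1, h2⟩ := entry_injective (List.ofFn_injective h.choose_spec)
  rw [wordValue, dif_pos h, ← h1, ← h2]

theorem exists_of_isEntryList {p q : List (Fin n × Fin n)} {a b c d : Fin n}
    (h : IsEntryList (p ++ (a, c) :: (b, d) :: q)) :
    ∃ (u v : Equiv.Perm (Fin n)) (j : Fin (n - 1)),
      (u⁻¹ (lo j) = a ∧ u⁻¹ (hi j) = b ∧ v⁻¹ (lo j) = c ∧ v⁻¹ (hi j) = d) ∧
      p ++ (a, c) :: (b, d) :: q = List.ofFn (entry u v) ∧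
      p ++ (b, c) :: (a, d) :: q = List.ofFn (entry (s j * u) v) ∧
      p ++ (a, d) :: (b, c) :: q = List.ofFn (entry u (s j * v)) ∧
      p ++ (b, d) :: (a, c) :: q = List.ofFn (entry (s j * u) (s j * v)) := by
  obtain ⟨⟨u, v⟩, huv⟩ := h
  obtain ⟨j, h1, h2, hg⟩ := exists_of_ofFn_eq_append huv.symm
  simp only [entry, Prod.mk.injEq] at h1 h2
  obtain ⟨rfl, rfl⟩ := h1
  obtain ⟨rfl, rfl⟩ := h2
  refine ⟨u, v, j, ⟨rfl, rfl, rfl, rfl⟩, huv, ?_, ?_, ?_⟩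
  · rw [hg (entry (s j * u) v) fun i h1 h2 => by simp [entry, s_apply_of_ne h1 h2]]
    simp [entry]
  · rw [hg (entry u (s j * v)) fun i h1 h2 => by simp [entry, s_apply_of_ne h1 h2]]
    simp [entry]
  · rw [hg (entry (s j * u) (s j * v)) fun i h1 h2 => by simp [entry, s_apply_of_ne h1 h2]]
    simp [entry]

/-- A repeated row or column cannot occur in a word of some `x^{u,v}`; hence both sides of the
relations `row` and `col` have value zero. -/
theorem wordValue_eq_zero {p q : List (Fin n × Fin n)} {a b c d : Fin n} (h : a = b ∨ c = d) :
    wordValue (p ++ (a, c) :: (b, d) :: q) = 0 := by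
  refine dif_neg fun hl => ?_
  obtain ⟨u, v, j, ⟨rfl, rfl, rfl, rfl⟩, -⟩ := exists_of_isEntryList hl
  rcases h with h | h
  · exact lo_ne_hi j (u⁻¹.injective h)
  · exact lo_ne_hi j (v⁻¹.injective h)

theorem wordValue_eq_zero_of_swap {p q : List (Fin n × Fin n)} {a b c d : Fin n}
    (h : ¬IsEntryList (p ++ (a, c) :: (b, d) :: q)) :
    wordValue (p ++ (a, c) :: (b, d) :: q) = 0 ∧ wordValue (p ++ (b, c) :: (a, d) :: q) = 0 ∧
      wordValue (p ++ (a, d) :: (b, c) :: q) = 0 ∧ wordValue (p ++ (b, d) :: (a, c) :: q) = 0 := by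
  refine ⟨dif_neg h, dif_neg fun h' => h ?_, dif_neg fun h' => h ?_, dif_neg fun h' => h ?_⟩ <;>
  obtain ⟨u, v, j, -, -, h1, h2, h3⟩ := exists_of_isEntryList h'
  exacts [⟨(_, _), h1⟩, ⟨(_, _), h2⟩, ⟨(_, _), h3⟩]

theorem wordValue_anti {p q : List (Fin n × Fin n)} {i j k l : Fin n} (hij : i < j) (hkl : k < l) :
    wordValue (p ++ (j, k) :: (i, l) :: q) = wordValue (p ++ (i, l) :: (j, k) :: q) := by
  by_cases h : IsEntryList (p ++ (i, k) :: (j, l) :: q)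
  · obtain ⟨u, v, m, ⟨rfl, rfl, rfl, rfl⟩, -, h1, h2, -⟩ := exists_of_isEntryList h
    rw [h1, h2, wordValue_ofFn, wordValue_ofFn, heckeMon_s_mul hij,
      if_pos (show LeftAscent m v from hkl), add_zero]
  · obtain ⟨-, h1, h2, -⟩ := wordValue_eq_zero_of_swap h
    rw [h1, h2]

theorem wordValue_diag {p q : List (Fin n × Fin n)} {i j k l : Fin n} (hij : i < j) (hkl : k < l) :
    wordValue (p ++ (j, l) :: (i, k) :: q) = wordValue (p ++ (i, k) :: (j, l) :: q) +
      qdiff • wordValue (p ++ (i, l) :: (j, k) :: q) := by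
  by_cases h : IsEntryList (p ++ (i, k) :: (j, l) :: q)
  · obtain ⟨u, v, m, ⟨rfl, rfl, rfl, rfl⟩, h0, -, h2, h3⟩ := exists_of_isEntryList h
    -- The left side is the word of `x^{s_m u, s_m v}`, so the rule is applied at the descent `s_m
    -- v`.
    have hv : ¬LeftAscent m (s m * v) := by rw [leftAscent_s_mul]; exact not_not.mpr hkl
    rw [h0, h2, h3, wordValue_ofFn, wordValue_ofFn, wordValue_ofFn, heckeMon_s_mul hij,
      if_neg hv, s_mul_s_mul]
  · obtain ⟨h0, -, h2, h3⟩ := wordValue_eq_zero_of_swap h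
    rw [h0, h2, h3, smul_zero, add_zero]

/-! ### Descent of the word values to the quotient algebra -/

/-- The product of free generators along a list of index pairs. -/
def freeWord (l : List (Fin n × Fin n)) : FreeAlgebra L (Fin n × Fin n) :=
  (l.map (FreeAlgebra.ι L)).prod

theorem basisFreeMonoid_apply (m : FreeMonoid (Fin n × Fin n)) :
    FreeAlgebra.basisFreeMonoid L (Fin n × Fin n) m = freeWord m.toList := by
  simp [FreeAlgebra.basisFreeMonoid, FreeAlgebra.equivMonoidAlgebraFreeMonoid, freeWord,
    FreeMonoid.lift_apply]

/-- The linear extension of `wordValue` to the free algebra. -/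
def freeValue : FreeAlgebra L (Fin n × Fin n) →ₗ[L] Equiv.Perm (Fin n) →₀ L :=
  (FreeAlgebra.basisFreeMonoid L (Fin n × Fin n)).constr L fun m => wordValue m.toList

theorem freeValue_freeWord (l : List (Fin n × Fin n)) : freeValue (freeWord l) = wordValue l := by
  have := (FreeAlgebra.basisFreeMonoid L (Fin n × Fin n)).constr_basis L
    (fun m => wordValue m.toList) (FreeMonoid.ofList l)
  rwa [basisFreeMonoid_apply] at this

theorem freeAlgebra_induction {P : FreeAlgebra L (Fin n × Fin n) → Prop}
    (word : ∀ l, P (freeWord l)) (add : ∀ a b, P a → P b → P (a + b))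
    (smul : ∀ (c : L) a, P a → P (c • a)) (a : FreeAlgebra L (Fin n × Fin n)) : P a := by
  have ha := (FreeAlgebra.basisFreeMonoid L (Fin n × Fin n)).mem_span a
  induction ha using Submodule.span_induction with
  | mem _ h => obtain ⟨m, rfl⟩ := h; rw [basisFreeMonoid_apply]; exact word _
  | zero => simpa using smul 0 _ (word [])
  | add a b _ _ ha hb => exact add a b ha hb
  | smul c a _ ha => exact smul c a ha

theorem freeValue_word_mul_word (p q : List (Fin n × Fin n)) (i k j l : Fin n) :
    freeValue (freeWord p * (freeVar i k * freeVar j l) * freeWord q) =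
      wordValue (p ++ (i, k) :: (j, l) :: q) := by
  rw [← freeValue_freeWord]
  simp [freeWord, freeVar, mul_assoc]

theorem freeValue_rel_word {a b : FreeAlgebra L (Fin n × Fin n)} (h : Rel n a b)
    (p q : List (Fin n × Fin n)) :
    freeValue (freeWord p * a * freeWord q) = freeValue (freeWord p * b * freeWord q) := by
  cases h with
  | row i k l hkl =>
    rw [mul_smul_comm, smul_mul_assoc, map_smul, freeValue_word_mul_word, freeValue_word_mul_word,
      wordValue_eq_zero (Or.inl rfl), wordValue_eq_zero (Or.inl rfl), smul_zero]
  | col i j k hij =>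
    rw [mul_smul_comm, smul_mul_assoc, map_smul, freeValue_word_mul_word, freeValue_word_mul_word,
      wordValue_eq_zero (Or.inr rfl), wordValue_eq_zero (Or.inr rfl), smul_zero]
  | anti i j k l hij hkl =>
    rw [freeValue_word_mul_word, freeValue_word_mul_word, wordValue_anti hij hkl]
  | diag i j k l hij hkl =>
    rw [mul_add, add_mul, map_add, mul_smul_comm, smul_mul_assoc, map_smul,
      freeValue_word_mul_word, freeValue_word_mul_word, freeValue_word_mul_word,
      wordValue_diag hij hkl]

theorem freeValue_rel {a b : FreeAlgebra L (Fin n × Fin n)} (h : Rel n a b)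
    (p q : FreeAlgebra L (Fin n × Fin n)) : freeValue (p * a * q) = freeValue (p * b * q) := by
  induction p using freeAlgebra_induction with
  | add p p' hp hp' => simp only [add_mul, map_add, hp, hp']
  | smul c p hp => simp only [smul_mul_assoc, map_smul, hp]
  | word p =>
    induction q using freeAlgebra_induction with
    | add q q' hq hq' => simp only [mul_add, map_add, hq, hq']
    | smul c q hq => simp only [mul_smul_comm, map_smul, hq]
    | word q => exact freeValue_rel_word h p q

/-- `freeValue` is only linear, so the induction carries arbitrary factors `p` and `q`, which absorb
the multipliers in the generated congruence. -/
theorem freeValue_ringQuotRel {a b : FreeAlgebra L (Fin n × Fin n)} (h : RingQuot.Rel (Rel n) a b)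
    (p q : FreeAlgebra L (Fin n × Fin n)) : freeValue (p * a * q) = freeValue (p * b * q) := by
  induction h generalizing p q with
  | of h => exact freeValue_rel h p q
  | add_left _ ih => simp only [mul_add, add_mul, map_add, ih]
  | mul_left _ ih => simpa only [mul_assoc] using ih p (_ * q)
  | mul_right _ ih => simpa only [mul_assoc] using ih (p * _) q

theorem freeValue_eq_of_mkAlgHom_eq {a b : FreeAlgebra L (Fin n × Fin n)}
    (h : RingQuot.mkAlgHom L (Rel n) a = RingQuot.mkAlgHom L (Rel n) b) :
    freeValue a = freeValue b := by
  have h' : Quot.mk (RingQuot.Rel (Rel n)) a = Quot.mk (RingQuot.Rel (Rel n)) b := by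
    simpa [RingQuot.mkAlgHom_def, RingQuot.mkRingHom_def] using h
  clear h
  induction Quot.eqvGen_exact h' with
  | rel a b h => simpa using freeValue_ringQuotRel h 1 1
  | refl => rfl
  | symm _ _ h ih => exact (ih (Quot.eqvGen_sound h)).symm
  | trans _ _ _ h1 h2 ih1 ih2 =>
    exact (ih1 (Quot.eqvGen_sound h1)).trans (ih2 (Quot.eqvGen_sound h2))

theorem mkAlgHom_freeWord (l : List (Fin n × Fin n)) :
    RingQuot.mkAlgHom L (Rel n) (freeWord l) = xprod l := by
  rw [freeWord, map_list_prod, List.map_map]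
  rfl

theorem linearIndependent_mon (u : Equiv.Perm (Fin n)) : LinearIndependent L (mon u) := by
  let W : (Equiv.Perm (Fin n) →₀ L) →ₗ[L] FreeAlgebra L (Fin n × Fin n) :=
    Finsupp.linearCombination L fun v => freeWord (List.ofFn (entry u v))
  have hA : Finsupp.linearCombination L (mon u) =
      (RingQuot.mkAlgHom L (Rel n)).toLinearMap ∘ₗ W :=
    Finsupp.lhom_ext' fun v => LinearMap.ext_ring (by simp [W, mkAlgHom_freeWord, mon_eq_xprod])
  have hF : freeValue ∘ₗ W = leftMulPerm u⁻¹ :=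
    end_ext fun v => by simp [W, freeValue_freeWord, wordValue_ofFn, heckeMon]
  intro c d h
  rw [hA] at h
  have h' := freeValue_eq_of_mkAlgHom_eq h
  rw [← LinearMap.comp_apply, ← LinearMap.comp_apply, hF] at h'
  exact leftMulWord_injective _ h'

end Independence

/- ### Counting walks and transition polynomials -/

section Walks

variable {n : ℕ}

theorem walks_nil (v w : Equiv.Perm (Fin n)) (b : ℕ) :
    walks ([] : List (Fin (n - 1))) v w b = if v = w ∧ b = 0 then {fun _ => v} else ∅ := by
  ext π
  have he : {j : Fin ([] : List (Fin (n - 1))).length | π j.succ = π j.castSucc} = ∅ :=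
    Set.eq_empty_of_forall_notMem fun j => j.elim0
  constructor
  · rintro ⟨rfl, rfl, -, -, hb⟩
    rw [he, Set.ncard_empty] at hb
    rw [if_pos ⟨rfl, hb.symm⟩]
    exact funext fun i => congrArg π (Subsingleton.elim (α := Fin 1) i 0)
  · split_ifs with h
    · rintro rfl
      exact ⟨rfl, h.1, fun j => j.elim0, fun j => j.elim0, by rw [he, Set.ncard_empty, h.2]⟩
    · exact False.elim

/-- The walk `π` preceded by the permutation `v`. -/
def consWalk {k : ℕ} (v : Equiv.Perm (Fin n)) (π : Fin (k + 1) → Equiv.Perm (Fin n)) :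
    Fin (k + 1 + 1) → Equiv.Perm (Fin n) :=
  Fin.cons (α := fun _ => Equiv.Perm (Fin n)) v π

theorem consWalk_injective {k : ℕ} (v : Equiv.Perm (Fin n)) :
    Function.Injective (consWalk (k := k) v) :=
  Fin.cons_right_injective (α := fun _ => Equiv.Perm (Fin n)) v

theorem ncard_stays_consWalk {k : ℕ} (v : Equiv.Perm (Fin n))
    (π : Fin (k + 1) → Equiv.Perm (Fin n)) :
    {i : Fin (k + 1) | consWalk v π i.succ = consWalk v π i.castSucc}.ncard =
      {i : Fin k | π i.succ = π i.castSucc}.ncard + if π 0 = v then 1 else 0 := by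
  have h0 : consWalk v π (Fin.succ 0) = consWalk v π (Fin.castSucc 0) ↔ π 0 = v := Iff.rfl
  have hs : ∀ i : Fin k, consWalk v π i.succ.succ = consWalk v π i.succ.castSucc ↔
      π i.succ = π i.castSucc := fun _ => Iff.rfl
  have e : {i : Fin (k + 1) | consWalk v π i.succ = consWalk v π i.castSucc} =
      (Fin.succ '' {i : Fin k | π i.succ = π i.castSucc}) ∪ if π 0 = v then {0} else ∅ := by
    ext i
    refine Fin.cases ?_ (fun i => ?_) i
    · by_cases h : π 0 = v <;> simp only [Set.mem_ofPred_eq, h0] <;> simp [h]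
    · by_cases h : π 0 = v <;> simp only [Set.mem_ofPred_eq, hs] <;> simp [h]
  rw [e, Set.ncard_union_eq _ (Set.toFinite _) (Set.toFinite _),
    Set.ncard_image_of_injective _ (Fin.succ_injective _)]
  · split_ifs <;> simp
  · split_ifs <;> simp

theorem consWalk_mem_walks_cons (j : Fin (n - 1)) (l : List (Fin (n - 1)))
    (v w v' : Equiv.Perm (Fin n)) (b : ℕ) (π : Fin (l.length + 1) → Equiv.Perm (Fin n)) :
    consWalk v' π ∈ walks (j :: l) v w b ↔
      v' = v ∧ (π ∈ walks l (s j * v) w b ∨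
        ¬LeftAscent j v ∧ ∃ b', b = b' + 1 ∧ π ∈ walks l v w b') := by
  have h : consWalk v' π ∈ walks (j :: l) v w b ↔
      v' = v ∧ π (Fin.last l.length) = w ∧
      ((π 0 = s j * v' ∨ π 0 = v') ∧ ∀ i : Fin l.length,
        π i.succ = s (l.get i) * π i.castSucc ∨ π i.succ = π i.castSucc) ∧
      ((BruhatLT v' (s j * v') → π 0 = s j * v') ∧ ∀ i : Fin l.length,
        BruhatLT (π i.castSucc) (s (l.get i) * π i.castSucc) →
          π i.succ = s (l.get i) * π i.castSucc) ∧
      {i : Fin l.length | π i.succ = π i.castSucc}.ncard + (if π 0 = v' then 1 else 0) = b := by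
    rw [← ncard_stays_consWalk]
    exact and_congr Iff.rfl (and_congr Iff.rfl
      (and_congr Fin.forall_fin_succ (and_congr Fin.forall_fin_succ Iff.rfl)))
  rw [h, bruhatLT_s_mul_iff]
  constructor
  · rintro ⟨rfl, hw, ⟨h0, h1⟩, ⟨h2, h3⟩, hb⟩
    refine ⟨rfl, ?_⟩
    rcases h0 with h0 | h0
    · refine Or.inl ⟨h0, hw, h1, h3, ?_⟩
      rwa [if_neg (by rw [h0]; exact s_mul_ne j v'), add_zero] at hb
    · refine Or.inr ⟨fun ha => s_mul_ne j v' ((h2 ha).symm.trans h0), _, ?_,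
        h0, hw, h1, h3, rfl⟩
      rw [if_pos h0] at hb
      exact hb.symm
  · rintro ⟨rfl, ⟨h0, hw, h1, h3, hb⟩ | ⟨ha, b', rfl, h0, hw, h1, h3, hb⟩⟩
    · refine ⟨rfl, hw, ⟨Or.inl h0, h1⟩, ⟨fun _ => h0, h3⟩, ?_⟩
      rw [if_neg (by rw [h0]; exact s_mul_ne j v'), add_zero, hb]
    · refine ⟨rfl, hw, ⟨Or.inr h0, h1⟩, ⟨fun h => absurd h ha, h3⟩, ?_⟩
      rw [if_pos h0, hb]

theorem walks_cons (j : Fin (n - 1)) (l : List (Fin (n - 1))) (v w : Equiv.Perm (Fin n)) (b : ℕ) :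
    walks (j :: l) v w b = consWalk v '' (walks l (s j * v) w b ∪
      {π | ¬LeftAscent j v ∧ ∃ b', b = b' + 1 ∧ π ∈ walks l v w b'}) := by
  ext π
  obtain ⟨v', π, rfl⟩ : ∃ v' π', π = consWalk (k := l.length) v' π' :=
    ⟨_, _, (Fin.cons_self_tail (α := fun _ => Equiv.Perm (Fin n)) π).symm⟩
  refine (consWalk_mem_walks_cons j l v w v' b π).trans ?_
  constructor
  · rintro ⟨rfl, h⟩
    exact ⟨π, h, rfl⟩
  · rintro ⟨π', h', h⟩
    obtain ⟨h1, h2⟩ := (Fin.cons_inj (α := fun _ => Equiv.Perm (Fin n))).mp h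
    exact ⟨h1.symm, h2 ▸ h'⟩

theorem ncard_walks_cons (j : Fin (n - 1)) (l : List (Fin (n - 1))) (v w : Equiv.Perm (Fin n))
    (b : ℕ) :
    (walks (j :: l) v w b).ncard = (walks l (s j * v) w b).ncard +
      if LeftAscent j v then 0 else if b = 0 then 0 else (walks l v w (b - 1)).ncard := by
  have hset : {π | ¬LeftAscent j v ∧ ∃ b', b = b' + 1 ∧ π ∈ walks l v w b'} =
      if LeftAscent j v then ∅ else if b = 0 then ∅ else walks l v w (b - 1) := by
    ext π
    rcases b with _ | b <;> by_cases h : LeftAscent j v <;> simp [h]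
  rw [walks_cons, Set.ncard_image_of_injective _ (consWalk_injective v),
    Set.ncard_union_eq ?_ (Set.toFinite _) (Set.toFinite _), hset]
  · split_ifs <;> simp
  · rw [Set.disjoint_left]
    rintro π h ⟨-, b', -, h'⟩
    exact s_mul_ne j v (h.1.symm.trans h'.1)

theorem walks_eq_empty {l : List (Fin (n - 1))} (v w : Equiv.Perm (Fin n)) {b : ℕ}
    (hb : l.length < b) : walks l v w b = ∅ := by
  refine Set.eq_empty_of_forall_notMem fun π hπ => ?_
  have h := Set.ncard_le_card {j : Fin l.length | π j.succ = π j.castSucc}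
  rw [hπ.2.2.2.2, Nat.card_fin] at h
  omega

theorem coeff_walkPoly (l : List (Fin (n - 1))) (v w : Equiv.Perm (Fin n)) (b : ℕ) :
    (walkPoly l v w).coeff b = (walks l v w b).ncard := by
  simp only [walkPoly, finsetSum_coeff, coeff_C_mul_X_pow]
  rw [Finset.sum_ite_eq]
  split_ifs with h
  · rfl
  · rw [walks_eq_empty v w (by simpa using h), Set.ncard_empty]

theorem walkPoly_nil (v w : Equiv.Perm (Fin n)) :
    walkPoly ([] : List (Fin (n - 1))) v w = if v = w then 1 else 0 := by
  ext b
  rw [coeff_walkPoly, walks_nil]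
  by_cases h : v = w <;> by_cases hb : b = 0 <;> simp [h, hb, coeff_one]

/-- A walk first moves to `s_j v`, or stays at `v` at the cost of one factor `X`, which is allowed
only at a descent. This mirrors `mon_s_mul`. -/
theorem walkPoly_cons (j : Fin (n - 1)) (l : List (Fin (n - 1))) (v w : Equiv.Perm (Fin n)) :
    walkPoly (j :: l) v w =
      walkPoly l (s j * v) w + if LeftAscent j v then 0 else X * walkPoly l v w := by
  ext b
  rw [coeff_walkPoly, ncard_walks_cons, coeff_add, coeff_walkPoly]
  congr 1
  by_cases h : LeftAscent j v
  · simp [h]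
  · rcases b with _ | b <;> simp [h, coeff_walkPoly, coeff_X_mul]

theorem mon_wordProd_append {l m : List (Fin (n - 1))} {u : Equiv.Perm (Fin n)}
    (h : IsReducedExpr (l ++ m) u) (v : Equiv.Perm (Fin n)) :
    mon u v = ∑ w, (aeval qdiff (walkPoly l v w) : L) • mon (wordProd m) w := by
  induction l generalizing u v with
  | nil =>
    rw [← h.1, Finset.sum_eq_single v]
    · simp [walkPoly_nil]
    · intro w _ hw
      simp [walkPoly_nil, hw.symm]
    · simp
  | cons j l ih =>
    have ht : IsReducedExpr (l ++ m) (wordProd (l ++ m)) := h.tail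
    rw [← h.1, List.cons_append, wordProd_cons, mon_s_mul (IsReducedExpr.leftAscent (l := l ++ m) h), ih ht, ih ht v]
    simp only [walkPoly_cons, map_add, add_smul, Finset.sum_add_distrib]
    congr 1
    split_ifs
    · simp
    · simp [Finset.smul_sum, mul_smul]

theorem aeval_qdiff_injective :
    Function.Injective fun p : ℕ[X] => (aeval qdiff p : L) := by
  intro p q h
  have heval : ∀ y : ℝ, eval₂ (Nat.castRingHom ℝ) y p = eval₂ (Nat.castRingHom ℝ) y q := by
    intro y
    -- This is the positive root of `z² = y z + 1`, so sending `q^{1/2}` to it sends `q^{1/2} -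
    -- q^{-1/2}` to the arbitrary real `y`.
    have hpos : 0 < (y + √(y ^ 2 + 4)) / 2 := by
      have h1 : |y| < √(y ^ 2 + 4) := by
        rw [← Real.sqrt_sq_eq_abs]
        exact Real.sqrt_lt_sqrt (sq_nonneg y) (by linarith)
      linarith [neg_abs_le y]
    let z : ℝˣ := Units.mk0 _ hpos.ne'
    let e : L →+* ℝ := LaurentPolynomial.eval₂ (Int.castRingHom ℝ) z
    have hz : e qdiff = y := by
      have h1 : e (T 1) = (z : ℝ) := by
        simpa only [zpow_one] using LaurentPolynomial.eval₂_T (Int.castRingHom ℝ) z 1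
      have h2 : e (T (-1)) = (z : ℝ)⁻¹ := by
        simpa only [zpow_neg_one, Units.val_inv_eq_inv_val] using
          LaurentPolynomial.eval₂_T (Int.castRingHom ℝ) z (-1)
      have h3 : √(y ^ 2 + 4) ^ 2 = y ^ 2 + 4 := Real.sq_sqrt (by positivity)
      rw [qdiff, map_sub, h1, h2, sub_eq_iff_eq_add]
      have h4 : (z : ℝ) = (y + √(y ^ 2 + 4)) / 2 := rfl
      have h5 : (z : ℝ) * z = y * z + 1 := by rw [h4]; nlinarith
      field_simp
      linarith
    have key : ∀ r : ℕ[X], e (aeval qdiff r) = eval₂ (Nat.castRingHom ℝ) y r := fun r => by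
      rw [aeval_def, hom_eval₂, hz]
      congr 1
      exact Subsingleton.elim _ _
    rw [← key, ← key]
    exact congrArg e h
  have hmap : p.map (Nat.castRingHom ℝ) = q.map (Nat.castRingHom ℝ) :=
    Polynomial.funext fun y => by simpa [eval_map] using heval y
  exact Polynomial.map_injective _ Nat.cast_injective hmap

theorem IsTransition.unique {u t : Equiv.Perm (Fin n)}
    {r r' : Equiv.Perm (Fin n) → Equiv.Perm (Fin n) → ℕ[X]} (h : IsTransition u t r)
    (h' : IsTransition u t r') : r = r' := by
  funext v w
  apply aeval_qdiff_injective
  have hc := (h v).symm.trans (h' v)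
  exact Fintype.linearIndependent_iffₛ.mp (linearIndependent_mon t) _ _ hc w

theorem isTransition_walkPoly {t u : Equiv.Perm (Fin n)} (htu : WeakLE t u)
    {l : List (Fin (n - 1))} (hl : IsReducedExpr l (u * t⁻¹)) : IsTransition u t (walkPoly l) := by
  obtain ⟨m, hm, h⟩ := htu.exists_isReducedExpr_append
  intro v
  rw [mon_wordProd_append (h l hl) v, hm.1]

end Walks

end

end QuantumMatrix

theorem theorem2p6 (n : ℕ) (t u : Equiv.Perm (Fin n)) (htu : QuantumMatrix.WeakLE t u) :
    -- the monomials `x^{t,w}` form a basis of the zero-weight space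
    (LinearIndependent QuantumMatrix.L (QuantumMatrix.mon t) ∧
      Submodule.span QuantumMatrix.L (Set.range (QuantumMatrix.mon t)) =
        QuantumMatrix.zeroWeightSpace n) ∧
    -- the transition polynomials are well defined
    (∃! r : Equiv.Perm (Fin n) → Equiv.Perm (Fin n) → Polynomial ℕ,
      QuantumMatrix.IsTransition u t r) ∧
    -- and they are the walk-counting polynomials of any reduced expression for `u t⁻¹`
    ∀ r : Equiv.Perm (Fin n) → Equiv.Perm (Fin n) → Polynomial ℕ,
      QuantumMatrix.IsTransition u t r →
      ∀ l : List (Fin (n - 1)), QuantumMatrix.IsReducedExpr l (u * t⁻¹) →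
      ∀ v w : Equiv.Perm (Fin n), r v w = QuantumMatrix.walkPoly l v w := by
  refine ⟨⟨QuantumMatrix.linearIndependent_mon t, QuantumMatrix.span_mon t⟩, ?_, ?_⟩
  · obtain ⟨l, hl⟩ := QuantumMatrix.exists_isReducedExpr (u * t⁻¹)
    exact ⟨_, QuantumMatrix.isTransition_walkPoly htu hl, fun r hr =>
      hr.unique (QuantumMatrix.isTransition_walkPoly htu hl)⟩
  · intro r hr l hl v w
    rw [hr.unique (QuantumMatrix.isTransition_walkPoly htu hl)]
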